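/- Let $n,m,p,q,G\in\mathbb N$, and let $\mathbb R^p=\bigoplus_{g=1}^q V_g$ be a direct sum of subspaces $V_g$ all of the same dimension $G$. Write $u=\sum_{g=1}^q u_g$ with $u_g\in V_g$ and put $\|u\|_{\ell_1/\ell_2}=\sum_{g=1}^q\|u_g\|$, where $\|\cdot\|$ is the Euclidean norm. Let $\Phi:\mathbb R^n\to\mathbb R^m$ and $D:\mathbb R^p\to\mathbb R^n$ be linear, with $D^*$ the adjoint of $D$, let $\mu>0$, and let $f:\mathbb R^m\to\mathbb R\cup\{+\infty\}$ be a convex function that is twice continuously differentiable on the interior of its domain $\operatorname{dom} f=\{z: f(z)<\infty\}$, with $\nabla^2 f(z)$ positive definite for every $z\in\operatorname{int}(\operatorname{dom} f)$. Consider the problem $$\min_{x\in\mathbb R^n}\ \Theta(x):=f(\Phi x)+\mu\|D^*x\|_{\ell_1/\ell_2}\qquad(\mathrm{P})$$ and, for $x_0\in\mathbb R^n$, the problem $$\min_{x\in\mathbb R^n}\ \|D^*x\|_{\ell_1/\ell_2}\quad\text{subject to}\quad \Phi x=\Phi x_0.\qquad(\mathrm{ITV})$$ A point $\bar x$ is called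 a strong solution of $\min\varphi$, for $\varphi:\mathbb R^n\to\mathbb R\cup\{+\infty\}$, if there are $\kappa>0$ and $\delta>0$ with $\varphi(x)\ge\varphi(\bar x)+\frac{\kappa}{2}\|x-\bar x\|^2$ for all $x$ with $\|x-\bar x\|\le\delta$; a strong solution of (ITV) is a strong solution of $\min\Psi$, where $\Psi(x)=\|D^*x\|_{\ell_1/\ell_2}$ if $\Phi x=\Phi x_0$ and $\Psi(x)=+\infty$ otherwise. Suppose that $\bar x$ is an optimal solution of (P) with $\Phi\bar x\in\operatorname{int}(\operatorname{dom} f)$. Then the following are equivalent: 1. $\bar x$ is the unique optimal solution of (P); 2. $\bar x$ is a strong solution of (P); 3. $\bar x$ is a strong solution of (ITV) with $x_0=\bar x$. -/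

import Mathlib

noncomputable section

namespace GroupSparsity

/-- `x` is an optimal solution of `min φ`, for `φ` with values in `ℝ ∪ {+∞}`. -/
def IsSolution {E : Type*} (φ : E → WithTop ℝ) (x : E) : Prop :=
  ∀ y, φ x ≤ φ y

/-- `x` is the unique optimal solution of `min φ`. -/
def IsUniqueSolution {E : Type*} (φ : E → WithTop ℝ) (x : E) : Prop :=
  IsSolution φ x ∧ ∀ y, IsSolution φ y → y = x

/-- `x` is a strong solution of `min φ` (local quadratic growth around `x`). -/
def IsStrongSolution {E : Type*} [NormedAddCommGroup E] (φ : E → WithTop ℝ) (x : E) : Prop :=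
  ∃ κ : ℝ, 0 < κ ∧ ∃ δ : ℝ, 0 < δ ∧
    ∀ y ∈ Metric.closedBall x δ, φ x + ((κ / 2 * ‖y - x‖ ^ 2 : ℝ) : WithTop ℝ) ≤ φ y

/-- The effective domain `{z | f z < +∞}`. -/
def dom {F : Type*} (f : F → WithTop ℝ) : Set F :=
  {z | f z < ⊤}

/-- The real-valued function agreeing with `f` on its effective domain
(the value `0` taken outside the domain is irrelevant). -/
def finitePart {F : Type*} (f : F → WithTop ℝ) : F → ℝ :=
  fun z => (f z).untopD 0

/-- Convexity of an extended real-valued function: its epigraph is convex. -/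
def IsConvex {F : Type*} [AddCommGroup F] [Module ℝ F] (f : F → WithTop ℝ) : Prop :=
  Convex ℝ {p : F × ℝ | f p.1 ≤ (p.2 : WithTop ℝ)}

/-- The Hessian of `f` is positive definite at `z`. -/
def HessianPosDef {F : Type*} [NormedAddCommGroup F] [NormedSpace ℝ F]
    (f : F → WithTop ℝ) (z : F) : Prop :=
  ∀ w : F, w ≠ 0 → 0 < fderiv ℝ (fderiv ℝ (finitePart f)) z w w

open scoped Classical in
/-- The indicator function of a set, `0` on the set and `+∞` elsewhere. -/
def indicator {E : Type*} (C : Set E) : E → WithTop ℝ :=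
  fun x => if x ∈ C then 0 else ⊤

/-- The component `u_g ∈ V g` of `u`, for a direct sum decomposition of the space
into the subspaces `V g`. -/
def groupComponent {E : Type*} [AddCommGroup E] [Module ℝ E] {q : ℕ}
    (V : Fin q → Submodule ℝ E) (hV : DirectSum.IsInternal V) (u : E) (g : Fin q) : V g :=
  (LinearEquiv.ofBijective (DirectSum.coeLinearMap V) hV).symm u g

/-- The `ℓ1/ℓ2` norm `∑ g, ‖u_g‖`. -/
def groupNorm {E : Type*} [NormedAddCommGroup E] [NormedSpace ℝ E] {q : ℕ}
    (V : Fin q → Submodule ℝ E) (hV : DirectSum.IsInternal V) (u : E) : ℝ :=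
  ∑ g, ‖groupComponent V hV u g‖

/-- The objective `f (Φ x) + μ ‖D^* x‖_{ℓ1/ℓ2}` of the regularized problem. -/
def regularizedObjective {n m p q : ℕ}
    (V : Fin q → Submodule ℝ (EuclideanSpace ℝ (Fin p))) (hV : DirectSum.IsInternal V)
    (Φ : EuclideanSpace ℝ (Fin n) →ₗ[ℝ] EuclideanSpace ℝ (Fin m))
    (D : EuclideanSpace ℝ (Fin p) →ₗ[ℝ] EuclideanSpace ℝ (Fin n))
    (f : EuclideanSpace ℝ (Fin m) → WithTop ℝ) (μ : ℝ) :
    EuclideanSpace ℝ (Fin n) → WithTop ℝ :=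
  fun x => f (Φ x) + ((μ * groupNorm V hV (LinearMap.adjoint D x) : ℝ) : WithTop ℝ)

/-- The constrained problem `min ‖D^* x‖_{ℓ1/ℓ2}` subject to `Φ x = Φ x₀`,
as the minimization of an extended real-valued function. -/
def constrainedObjective {n m p q : ℕ}
    (V : Fin q → Submodule ℝ (EuclideanSpace ℝ (Fin p))) (hV : DirectSum.IsInternal V)
    (Φ : EuclideanSpace ℝ (Fin n) →ₗ[ℝ] EuclideanSpace ℝ (Fin m))
    (D : EuclideanSpace ℝ (Fin p) →ₗ[ℝ] EuclideanSpace ℝ (Fin n))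
    (x₀ : EuclideanSpace ℝ (Fin n)) :
    EuclideanSpace ℝ (Fin n) → WithTop ℝ :=
  fun x => ((groupNorm V hV (LinearMap.adjoint D x) : ℝ) : WithTop ℝ)
    + indicator {y | Φ y = Φ x₀} x

end GroupSparsity

end

/-! All three properties are equivalent to one kernel condition at `xbar`: no nonzero `w` satisfies
`Φ w = 0`, zero total `normCurvature` and zero total `normSlope`, taken over the groups of `D^*`.

If such a `w` exists, every group norm is affine for small `t > 0` along `xbar + t • w`, and the
slopes cancel. Neither `Φ` nor the sum of norms changes, so (P) has other minimizers and (ITV) has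
no quadratic growth (the two `kernel` lemmas).

Conversely, a second-order lower bound for each norm (`le_norm_add`) and for `f` gives an increment
of at least `A d + B d`. The directional derivative `A` is positively homogeneous and, by
optimality, nonnegative; `B ≥ 0` is quadratic. Under the kernel condition `A + B` is positive on the
unit sphere, and compactness gives growth (`quadratic_growth`). Convexity of `f` serves only to pass
from local growth to global uniqueness. -/

open Filter Topology

namespace GroupSparsity

/-! ### First- and second-order expansions of a Hilbert norm -/

section Norm

variable {H : Type*} [NormedAddCommGroup H] [InnerProductSpace ℝ H]

open scoped Classical in
/-- The one-sided directional derivative of the norm at `u` in the direction `v`. -/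
noncomputable def normSlope (u v : H) : ℝ := if u = 0 then ‖v‖ else inner ℝ u v / ‖u‖

/-- The defect in the Cauchy-Schwarz inequality, which governs the curvature of the norm. -/
noncomputable def normCurvature (u v : H) : ℝ := ‖u‖ ^ 2 * ‖v‖ ^ 2 - inner ℝ u v ^ 2

lemma normCurvature_nonneg (u v : H) : 0 ≤ normCurvature u v := by
  have h := abs_real_inner_le_norm u v
  have h2 := sq_le_sq' (by linarith [neg_abs_le (inner ℝ u v), abs_nonneg (inner ℝ u v)])
    ((le_abs_self _).trans h)
  unfold normCurvature
  nlinarith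

lemma normSlope_smul (u v : H) {t : ℝ} (ht : 0 ≤ t) :
    normSlope u (t • v) = t * normSlope u v := by
  unfold normSlope
  split_ifs
  · rw [norm_smul, Real.norm_of_nonneg ht]
  · rw [inner_smul_right, mul_div_assoc]

lemma normCurvature_smul (u v : H) (t : ℝ) :
    normCurvature u (t • v) = t ^ 2 * normCurvature u v := by
  unfold normCurvature
  rw [inner_smul_right, norm_smul, mul_pow, Real.norm_eq_abs, sq_abs]
  ring

lemma continuous_normSlope (u : H) : Continuous (normSlope u) := by
  unfold normSlope
  split_ifs <;> fun_prop

lemma continuous_normCurvature (u : H) : Continuous (normCurvature u) := by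
  unfold normCurvature
  fun_prop

/-- This is `2‖u‖‖u + t • v‖ ≤ ‖u‖² + ‖u + t • v‖²`, divided by `2‖u‖`. `C` may depend on `v`, since
the bound is only used along a fixed ray. -/
lemma norm_add_smul_le (u v : H) :
    ∃ C : ℝ, ∀ t : ℝ, 0 ≤ t → ‖u + t • v‖ ≤ ‖u‖ + t * normSlope u v + C * t ^ 2 := by
  by_cases hu : u = 0
  · refine ⟨0, fun t ht => ?_⟩
    simp [normSlope, hu, norm_smul, abs_of_nonneg ht]
  · have hpos : 0 < ‖u‖ := norm_pos_iff.2 hu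
    refine ⟨‖v‖ ^ 2 / (2 * ‖u‖), fun t _ => ?_⟩
    have h1 := norm_add_sq_real u (t • v)
    rw [inner_smul_right, norm_smul, mul_pow, Real.norm_eq_abs, sq_abs] at h1
    rw [normSlope, if_neg hu]
    have h2 : ‖u‖ + t * (inner ℝ u v / ‖u‖) + ‖v‖ ^ 2 / (2 * ‖u‖) * t ^ 2
        = (2 * ‖u‖ ^ 2 + 2 * t * inner ℝ u v + t ^ 2 * ‖v‖ ^ 2) / (2 * ‖u‖) := by
      field_simp
    rw [h2, le_div_iff₀ (by positivity)]
    nlinarith [sq_nonneg (‖u‖ - ‖u + t • v‖)]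

/-- With `a` the slope, `‖u + v‖² - (‖u‖ + a)² = ‖v‖² - a²`, which is the curvature over `‖u‖²`. For
`‖v‖ ≤ ‖u‖` the two roots sum to at most `4‖u‖`, hence the constant `1 / (4‖u‖³)`, uniform in `v`.
-/
lemma le_norm_add (u : H) :
    ∃ c : ℝ, 0 < c ∧ ∃ δ : ℝ, 0 < δ ∧ ∀ v : H, ‖v‖ ≤ δ →
      ‖u‖ + normSlope u v + c * normCurvature u v ≤ ‖u + v‖ := by
  by_cases hu : u = 0
  · refine ⟨1, one_pos, 1, one_pos, fun v _ => ?_⟩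
    simp [normSlope, normCurvature, hu]
  · have hpos : 0 < ‖u‖ := norm_pos_iff.2 hu
    refine ⟨1 / (4 * ‖u‖ ^ 3), by positivity, ‖u‖, hpos, fun v hv => ?_⟩
    have h1 := norm_add_sq_real u v
    rw [normSlope, if_neg hu, normCurvature]
    set a := inner ℝ u v / ‖u‖ with ha
    have hin : inner ℝ u v = a * ‖u‖ := by rw [ha]; field_simp
    have habs : |a| ≤ ‖v‖ := by
      rw [ha, abs_div, abs_norm, div_le_iff₀ hpos, mul_comm]
      exact abs_real_inner_le_norm u v
    have hb : 0 ≤ ‖v‖ ^ 2 - a ^ 2 := by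
      have := sq_le_sq' (by linarith [neg_abs_le a]) ((le_abs_self a).trans habs)
      linarith
    have hr : 0 ≤ ‖u‖ + a := by linarith [neg_abs_le a]
    have hR : ‖u + v‖ ≤ 2 * ‖u‖ := (norm_add_le u v).trans (by linarith)
    have hsq : ‖u + v‖ ^ 2 = (‖u‖ + a) ^ 2 + (‖v‖ ^ 2 - a ^ 2) := by
      rw [h1, hin]; ring
    have hrR : ‖u‖ + a ≤ ‖u + v‖ := by
      refine (sq_le_sq₀ hr (norm_nonneg _)).1 ?_
      linarith
    have hmain : ‖v‖ ^ 2 - a ^ 2 ≤ (‖u + v‖ - (‖u‖ + a)) * (4 * ‖u‖) := by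
      have : ‖v‖ ^ 2 - a ^ 2 = (‖u + v‖ - (‖u‖ + a)) * (‖u + v‖ + (‖u‖ + a)) := by
        nlinarith
      rw [this]
      exact mul_le_mul_of_nonneg_left (by linarith) (by linarith)
    have heq : 1 / (4 * ‖u‖ ^ 3) * (‖u‖ ^ 2 * ‖v‖ ^ 2 - inner ℝ u v ^ 2)
        = (‖v‖ ^ 2 - a ^ 2) / (4 * ‖u‖) := by
      rw [hin]; field_simp
    rw [heq]
    have := (div_le_iff₀ (by positivity : (0 : ℝ) < 4 * ‖u‖)).2 hmain
    linarith

/-- Equality in Cauchy-Schwarz makes `v` collinear with `u` when `u ≠ 0`, so the norm is affine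
until the ray reaches the origin; at `u = 0` it is positively homogeneous. -/
lemma eventually_norm_add_smul_eq {u v : H} (h : normCurvature u v = 0) :
    ∀ᶠ t : ℝ in 𝓝[>] 0, ‖u + t • v‖ = ‖u‖ + t * normSlope u v := by
  by_cases hu : u = 0
  · filter_upwards [self_mem_nhdsWithin] with t ht
    simp [normSlope, hu, norm_smul, abs_of_pos (Set.mem_Ioi.1 ht)]
  · have hpos : 0 < ‖u‖ := norm_pos_iff.2 hu
    have hcont : Tendsto (fun t : ℝ => ‖u‖ + t * normSlope u v) (𝓝 0) (𝓝 ‖u‖) := by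
      have : Continuous fun t : ℝ => ‖u‖ + t * normSlope u v := by fun_prop
      simpa using this.tendsto 0
    filter_upwards [nhdsWithin_le_nhds (hcont.eventually (lt_mem_nhds hpos))] with t ht
    have h1 := norm_add_sq_real u (t • v)
    rw [inner_smul_right, norm_smul, mul_pow, Real.norm_eq_abs, sq_abs] at h1
    have hs : inner ℝ u v = normSlope u v * ‖u‖ := by
      rw [normSlope, if_neg hu]; field_simp
    rw [normCurvature, hs] at h
    have hv : ‖v‖ ^ 2 = normSlope u v ^ 2 := by
      have : ‖u‖ ^ 2 * (‖v‖ ^ 2 - normSlope u v ^ 2) = 0 := by linarith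
      rcases mul_eq_zero.1 this with h0 | h0
      · exact absurd h0 (by positivity)
      · linarith
    rw [hs, hv] at h1
    exact (sq_eq_sq₀ (norm_nonneg _) ht.le).1 (by rw [h1]; ring)

end Norm

/-! ### Compactness on the sphere and second-order growth of smooth functions -/

section Growth

variable {E : Type*} [NormedAddCommGroup E] [NormedSpace ℝ E] [FiniteDimensional ℝ E]

lemma exists_pos_le_on_sphere {h : E → ℝ} (hc : Continuous h)
    (hpos : ∀ w, ‖w‖ = 1 → 0 < h w) : ∃ ε : ℝ, 0 < ε ∧ ∀ w, ‖w‖ = 1 → ε ≤ h w := by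
  have : ProperSpace E := FiniteDimensional.proper_real E
  rcases (Metric.sphere (0 : E) 1).eq_empty_or_nonempty with he | hne
  · refine ⟨1, one_pos, fun w hw => ?_⟩
    have : w ∈ Metric.sphere (0 : E) 1 := by simpa using hw
    simp [he] at this
  · obtain ⟨w₀, hw₀, hmin⟩ := (isCompact_sphere (0 : E) 1).exists_isMinOn hne hc.continuousOn
    exact ⟨h w₀, hpos _ (by simpa using hw₀), fun w hw => hmin (by simpa using hw)⟩

/-- Second-order growth of a `C²` function with positive definite second derivative. -/
lemma exists_le_add_of_hessian_pos {φ : E → ℝ} {z : E} (hφ : ContDiffAt ℝ 2 φ z)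
    (hpos : ∀ w, w ≠ 0 → 0 < fderiv ℝ (fderiv ℝ φ) z w w) :
    ∃ c : ℝ, 0 < c ∧ ∃ δ : ℝ, 0 < δ ∧ ∀ h : E, ‖h‖ ≤ δ →
      φ z + fderiv ℝ φ z h + c * ‖h‖ ^ 2 ≤ φ (z + h) := by
  obtain ⟨l, hl, hle⟩ := exists_pos_le_on_sphere
    (h := fun w => fderiv ℝ (fderiv ℝ φ) z w w) (by fun_prop)
    (fun w hw => hpos w (by rintro rfl; simp at hw))
  have hquad : ∀ h : E, l * ‖h‖ ^ 2 ≤ fderiv ℝ (fderiv ℝ φ) z h h := by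
    intro h
    by_cases h0 : h = 0
    · simp [h0]
    have hn : 0 < ‖h‖ := norm_pos_iff.2 h0
    have h1 := hle (‖h‖⁻¹ • h) (by rw [norm_smul, norm_inv, norm_norm]; field_simp)
    simp only [map_smul, _root_.smul_apply, smul_eq_mul] at h1
    have h2 := mul_le_mul_of_nonneg_right h1 (sq_nonneg ‖h‖)
    refine h2.trans_eq ?_
    field_simp
  have hdiff : DifferentiableAt ℝ (fderiv ℝ φ) z :=
    (hφ.fderiv_right (m := 1) (by norm_num)).differentiableAt (by norm_num)
  have hev1 : ∀ᶠ y in 𝓝 z, DifferentiableAt ℝ φ y := by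
    filter_upwards [hφ.eventually (by simp)] with y hy
    exact hy.differentiableAt (by norm_num)
  -- The remainder in the expansion of the derivative may consume half of the ellipticity constant
  -- `l`; integrating the other half gives `l / 4`.
  have hev2 := hdiff.hasFDerivAt.isLittleO.def (c := l / 2) (by positivity)
  obtain ⟨δ, hδ, hball⟩ := Metric.nhds_basis_closedBall.mem_iff.1 (hev1.and hev2)
  refine ⟨l / 4, by positivity, δ, hδ, fun h hh => ?_⟩
  have hin : ∀ t : ℝ, t ∈ Set.Icc (0 : ℝ) 1 → z + t • h ∈ Metric.closedBall z δ := by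
    intro t ht
    rw [mem_closedBall_iff_norm, add_sub_cancel_left, norm_smul, Real.norm_of_nonneg ht.1]
    exact (mul_le_of_le_one_left (norm_nonneg _) ht.2).trans hh
  have hder : ∀ t ∈ Set.Icc (0 : ℝ) 1, HasDerivAt
      (fun t : ℝ => φ (z + t • h) - t * fderiv ℝ φ z h - l / 4 * ‖h‖ ^ 2 * t ^ 2)
      (fderiv ℝ φ (z + t • h) h - fderiv ℝ φ z h - l / 4 * ‖h‖ ^ 2 * (2 * t)) t := by
    intro t ht
    have hline : HasDerivAt (fun t : ℝ => z + t • h) h t := by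
      simpa using ((hasDerivAt_id t).smul_const h).const_add z
    have h1 := (hball (hin t ht)).1.hasFDerivAt.comp_hasDerivAt t hline
    have h2 := (hasDerivAt_id t).mul_const (fderiv ℝ φ z h)
    have h3 := (hasDerivAt_pow 2 t).const_mul (l / 4 * ‖h‖ ^ 2)
    refine ((h1.sub h2).sub h3).congr_deriv ?_
    simp
  -- The derivative is at least `t‖h‖² (l - l/2 - l/2) = 0`; comparing `t = 0` with `t = 1` gives
  -- the claim.
  have hmono : MonotoneOn
      (fun t : ℝ => φ (z + t • h) - t * fderiv ℝ φ z h - l / 4 * ‖h‖ ^ 2 * t ^ 2)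
      (Set.Icc 0 1) := by
    refine monotoneOn_of_deriv_nonneg (convex_Icc 0 1)
      (fun t ht => (hder t ht).continuousAt.continuousWithinAt)
      (fun t ht => (hder t (interior_subset ht)).differentiableAt.differentiableWithinAt)
      (fun t ht => ?_)
    have ht' := interior_subset ht
    rw [(hder t ht').deriv]
    have h1 := (hball (hin t ht')).2
    rw [add_sub_cancel_left] at h1
    have h2 := (ContinuousLinearMap.le_opNorm _ h).trans
      (mul_le_mul_of_nonneg_right h1 (norm_nonneg h))
    simp only [_root_.sub_apply, map_smul, _root_.smul_apply,
      smul_eq_mul, Real.norm_eq_abs, norm_smul, abs_of_nonneg ht'.1] at h2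
    have h3 := (abs_le.1 h2).1
    have h4 := mul_le_mul_of_nonneg_left (hquad h) ht'.1
    nlinarith
  have := hmono (Set.left_mem_Icc.2 zero_le_one) (Set.right_mem_Icc.2 zero_le_one) zero_le_one
  simp at this
  linarith

end Growth

/-! ### Optimality and quadratic growth for a smooth term plus a sum of norms -/

section SumNorm

variable {E : Type*} [NormedAddCommGroup E] [NormedSpace ℝ E]
  {ι : Type*} [Fintype ι] {H : ι → Type*} [∀ i, NormedAddCommGroup (H i)]
  [∀ i, InnerProductSpace ℝ (H i)]

lemma sum_norm_add_smul_le (L : ∀ i, E →ₗ[ℝ] H i) (x w : E) :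
    ∃ C : ℝ, ∀ t : ℝ, 0 ≤ t → ∑ i, ‖L i (x + t • w)‖ ≤
      ∑ i, ‖L i x‖ + t * ∑ i, normSlope (L i x) (L i w) + C * t ^ 2 := by
  choose C hC using fun i => norm_add_smul_le (L i x) (L i w)
  refine ⟨∑ i, C i, fun t ht => ?_⟩
  rw [Finset.mul_sum, Finset.sum_mul, ← Finset.sum_add_distrib, ← Finset.sum_add_distrib]
  refine Finset.sum_le_sum fun i _ => ?_
  rw [map_add, map_smul]
  exact hC i t ht

lemma eventually_sum_norm_add_smul_eq (L : ∀ i, E →ₗ[ℝ] H i) (x w : E)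
    (h : ∑ i, normCurvature (L i x) (L i w) = 0) :
    ∀ᶠ t : ℝ in 𝓝[>] 0, ∑ i, ‖L i (x + t • w)‖ =
      ∑ i, ‖L i x‖ + t * ∑ i, normSlope (L i x) (L i w) := by
  have h0 := (Finset.sum_eq_zero_iff_of_nonneg fun i _ => normCurvature_nonneg _ _).1 h
  have hev := eventually_all.2 fun i => eventually_norm_add_smul_eq (h0 i (Finset.mem_univ i))
  filter_upwards [hev] with t ht
  rw [Finset.mul_sum, ← Finset.sum_add_distrib]
  refine Finset.sum_congr rfl fun i _ => ?_
  rw [map_add, map_smul]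
  exact ht i

lemma le_sum_norm_add [FiniteDimensional ℝ E] (L : ∀ i, E →ₗ[ℝ] H i) (x : E) :
    ∃ c : ℝ, 0 < c ∧ ∀ᶠ d in 𝓝 (0 : E),
      ∑ i, ‖L i x‖ + ∑ i, normSlope (L i x) (L i d)
        + c * ∑ i, normCurvature (L i x) (L i d) ≤ ∑ i, ‖L i (x + d)‖ := by
  choose c hc δ hδ hle using fun i => le_norm_add (L i x)
  obtain ⟨c₀, hc₀, hc₀le⟩ : ∃ c₀ : ℝ, 0 < c₀ ∧ ∀ i, c₀ ≤ c i := by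
    rcases isEmpty_or_nonempty ι with h | h
    · exact ⟨1, one_pos, fun i => h.elim i⟩
    · obtain ⟨i, hi⟩ := Finite.exists_min c
      exact ⟨c i, hc i, hi⟩
  refine ⟨c₀, hc₀, ?_⟩
  have hev : ∀ᶠ d in 𝓝 (0 : E), ∀ i, ‖L i d‖ < δ i := by
    refine eventually_all.2 fun i => ?_
    have hcont : Continuous fun d => ‖L i d‖ := (L i).continuous_of_finiteDimensional.norm
    have : Tendsto (fun d => ‖L i d‖) (𝓝 0) (𝓝 0) := by simpa using hcont.tendsto 0
    exact this.eventually (gt_mem_nhds (hδ i))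
  filter_upwards [hev] with d hd
  rw [Finset.mul_sum, ← Finset.sum_add_distrib, ← Finset.sum_add_distrib]
  refine Finset.sum_le_sum fun i _ => ?_
  rw [map_add]
  refine le_trans ?_ (hle i (L i d) (hd i).le)
  have := mul_le_mul_of_nonneg_right (hc₀le i) (normCurvature_nonneg (L i x) (L i d))
  linarith

variable {F : Type*} [NormedAddCommGroup F] [NormedSpace ℝ F]

/-- First-order optimality: the directional derivative of `φ ∘ Φ + μ ∑ ‖L i ·‖` is nonnegative
at a local minimizer. -/
lemma slope_nonneg_of_isLocalMin {L : ∀ i, E →ₗ[ℝ] H i} {Φ : E →ₗ[ℝ] F} {φ : F → ℝ} {μ : ℝ}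
    (hμ : 0 < μ) {x : E} (hφ : DifferentiableAt ℝ φ (Φ x))
    (hmin : IsLocalMin (fun y => φ (Φ y) + μ * ∑ i, ‖L i y‖) x) (w : E) :
    0 ≤ fderiv ℝ φ (Φ x) (Φ w) + μ * ∑ i, normSlope (L i x) (L i w) := by
  obtain ⟨C, hC⟩ := sum_norm_add_smul_le L x w
  set S := ∑ i, normSlope (L i x) (L i w)
  set N := ∑ i, ‖L i x‖
  have hline : HasDerivAt (fun t : ℝ => Φ x + t • Φ w) (Φ w) 0 := by
    simpa using ((hasDerivAt_id (0 : ℝ)).smul_const (Φ w)).const_add (Φ x)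
  have h1 : HasDerivAt (fun t : ℝ => φ (Φ x + t • Φ w)) (fderiv ℝ φ (Φ x) (Φ w)) 0 := by
    have hφ' : HasFDerivAt φ (fderiv ℝ φ (Φ x)) (Φ x + (0 : ℝ) • Φ w) := by
      simpa using hφ.hasFDerivAt
    exact hφ'.comp_hasDerivAt (0 : ℝ) hline
  have h2 : HasDerivAt (fun t : ℝ => μ * (N + t * S + C * t ^ 2)) (μ * S) 0 := by
    have h3 := ((hasDerivAt_id (0 : ℝ)).mul_const S).const_add N
    have h4 := (hasDerivAt_pow 2 (0 : ℝ)).const_mul C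
    simpa using (h3.add h4).const_mul μ
  -- The differentiated function majorizes the objective along the ray and equals it at `t = 0`, so
  -- local minimality makes its right difference quotients nonnegative.
  refine ge_of_tendsto (h1.add h2).tendsto_slope_zero_right ?_
  have hx : Tendsto (fun t : ℝ => x + t • w) (𝓝 0) (𝓝 x) := by
    have : Continuous fun t : ℝ => x + t • w := by fun_prop
    simpa using this.tendsto 0
  filter_upwards [nhdsWithin_le_nhds (hx.eventually hmin), self_mem_nhdsWithin] with t ht ht0
  have ht0 : 0 < t := ht0
  have h5 := mul_le_mul_of_nonneg_left (hC t ht0.le) hμ.le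
  simp only [map_add, map_smul] at ht h5
  simp only [smul_eq_mul, zero_add, Pi.add_apply, zero_smul, add_zero, zero_mul, ne_eq,
    OfNat.ofNat_ne_zero, not_false_eq_true, zero_pow, mul_zero]
  refine mul_nonneg (inv_nonneg.2 ht0.le) ?_
  linarith

/-- Quadratic growth when no nonzero direction is critical and without curvature. -/
lemma quadratic_growth [FiniteDimensional ℝ E] [FiniteDimensional ℝ F] {L : ∀ i, E →ₗ[ℝ] H i} {Φ : E →ₗ[ℝ] F} {φ : F → ℝ} {μ : ℝ}
    (hμ : 0 < μ) {x : E} (hφ : ContDiffAt ℝ 2 φ (Φ x))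
    (hpos : ∀ w, w ≠ 0 → 0 < fderiv ℝ (fderiv ℝ φ) (Φ x) w w)
    (hmin : IsLocalMin (fun y => φ (Φ y) + μ * ∑ i, ‖L i y‖) x)
    (hker : ∀ w, Φ w = 0 → ∑ i, normCurvature (L i x) (L i w) = 0 →
      ∑ i, normSlope (L i x) (L i w) = 0 → w = 0) :
    ∃ κ : ℝ, 0 < κ ∧ ∀ᶠ d in 𝓝 (0 : E),
      φ (Φ x) + μ * ∑ i, ‖L i x‖ + κ * ‖d‖ ^ 2 ≤ φ (Φ (x + d)) + μ * ∑ i, ‖L i (x + d)‖ := by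
  have hΦc : Continuous Φ := Φ.continuous_of_finiteDimensional
  have hLc : ∀ i, Continuous (L i) := fun i => (L i).continuous_of_finiteDimensional
  have hA := slope_nonneg_of_isLocalMin hμ (hφ.differentiableAt (by norm_num)) hmin
  have hQ : ∀ w, 0 ≤ ∑ i, normCurvature (L i x) (L i w) :=
    fun w => Finset.sum_nonneg fun i _ => normCurvature_nonneg _ _
  obtain ⟨c₁, hc₁, δ, hδ, hle₁⟩ := exists_le_add_of_hessian_pos hφ hpos
  obtain ⟨c₂, hc₂, hle₂⟩ := le_sum_norm_add L x
  have hcontA : Continuous fun w =>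
      fderiv ℝ φ (Φ x) (Φ w) + μ * ∑ i, normSlope (L i x) (L i w) :=
    ((fderiv ℝ φ (Φ x)).continuous.comp hΦc).add (continuous_const.mul
      (continuous_finsetSum _ fun i _ => (continuous_normSlope _).comp (hLc i)))
  have hcontB : Continuous fun w =>
      c₁ * ‖Φ w‖ ^ 2 + μ * (c₂ * ∑ i, normCurvature (L i x) (L i w)) :=
    (continuous_const.mul (hΦc.norm.pow 2)).add (continuous_const.mul (continuous_const.mul
      (continuous_finsetSum _ fun i _ => (continuous_normCurvature _).comp (hLc i))))
  have hB₁ : ∀ w, 0 ≤ c₁ * ‖Φ w‖ ^ 2 := fun w => by positivity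
  have hB₂ : ∀ w, 0 ≤ μ * (c₂ * ∑ i, normCurvature (L i x) (L i w)) :=
    fun w => mul_nonneg hμ.le (mul_nonneg hc₂.le (hQ w))
  obtain ⟨ε, hε, hεle⟩ := exists_pos_le_on_sphere (h := fun w =>
      (fderiv ℝ φ (Φ x) (Φ w) + μ * ∑ i, normSlope (L i x) (L i w))
      + (c₁ * ‖Φ w‖ ^ 2 + μ * (c₂ * ∑ i, normCurvature (L i x) (L i w))))
    (hcontA.add hcontB) (by
    intro w hw
    -- If the sum of these nonnegative terms vanishes, each does, and `hker` forces `w = 0`.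
    refine lt_of_le_of_ne (add_nonneg (hA w) (add_nonneg (hB₁ w) (hB₂ w))) fun h0 => ?_
    have hA0 := hA w
    have hB10 := hB₁ w
    have hB20 := hB₂ w
    have e1 : c₁ * ‖Φ w‖ ^ 2 = 0 := by linarith
    have e2 : μ * (c₂ * ∑ i, normCurvature (L i x) (L i w)) = 0 := by linarith
    have hΦw : Φ w = 0 := by simpa [hc₁.ne'] using e1
    have hcurv : ∑ i, normCurvature (L i x) (L i w) = 0 := by
      simpa only [mul_eq_zero, hμ.ne', hc₂.ne', false_or] using e2
    have e3 : fderiv ℝ φ (Φ x) (Φ w) + μ * ∑ i, normSlope (L i x) (L i w) = 0 := by linarith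
    have hsl : ∑ i, normSlope (L i x) (L i w) = 0 := by
      simpa only [hΦw, map_zero, zero_add, mul_eq_zero, hμ.ne', false_or] using e3
    have := hker w hΦw hcurv hsl
    simp [this] at hw)
  refine ⟨ε, hε, ?_⟩
  have hsmall : ∀ᶠ d in 𝓝 (0 : E), ‖Φ d‖ < δ := by
    have : Tendsto (fun d => ‖Φ d‖) (𝓝 0) (𝓝 0) := by simpa using hΦc.norm.tendsto 0
    exact this.eventually (gt_mem_nhds hδ)
  have hone : ∀ᶠ d in 𝓝 (0 : E), ‖d‖ < 1 := by
    have : Tendsto (fun d : E => ‖d‖) (𝓝 0) (𝓝 0) := by simpa using continuous_norm.tendsto (0 : E)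
    exact this.eventually (gt_mem_nhds one_pos)
  filter_upwards [hle₂, hsmall, hone] with d hd₂ hdδ hd1
  have hd₁ := hle₁ (Φ d) hdδ.le
  rw [← map_add] at hd₁
  have hd₃ := mul_le_mul_of_nonneg_left hd₂ hμ.le
  suffices hgoal : ε * ‖d‖ ^ 2 ≤
      (fderiv ℝ φ (Φ x) (Φ d) + μ * ∑ i, normSlope (L i x) (L i d))
      + (c₁ * ‖Φ d‖ ^ 2 + μ * (c₂ * ∑ i, normCurvature (L i x) (L i d))) by
    linarith
  by_cases hd0 : d = 0
  · subst hd0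
    simpa using add_nonneg (hA 0) (add_nonneg (hB₁ 0) (hB₂ 0))
  have hn : 0 < ‖d‖ := norm_pos_iff.2 hd0
  obtain ⟨w, hw, hdw⟩ : ∃ w : E, ‖w‖ = 1 ∧ d = ‖d‖ • w :=
    ⟨‖d‖⁻¹ • d, by rw [norm_smul, norm_inv, norm_norm]; field_simp,
      by rw [smul_smul, mul_inv_cancel₀ hn.ne', one_smul]⟩
  generalize ‖d‖ = t at *
  subst hdw
  have hkey := mul_le_mul_of_nonneg_right (hεle w hw) (sq_nonneg t)
  -- For `0 < t < 1`, `t * A w ≥ t² * A w`, so the first-order term is bounded below by a quadratic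
  -- one.
  have hAt := mul_nonneg (hA w) (mul_nonneg hn.le (sub_nonneg.2 hd1.le))
  simp only [map_smul, normSlope_smul _ _ hn.le, normCurvature_smul, norm_smul, mul_pow,
    Real.norm_eq_abs, sq_abs, smul_eq_mul, ← Finset.mul_sum]
  nlinarith

end SumNorm

/-! ### The kernel condition and the two optimization problems -/

section Problem

variable {n m p q : ℕ} (V : Fin q → Submodule ℝ (EuclideanSpace ℝ (Fin p)))
  (hV : DirectSum.IsInternal V)
  (Φ : EuclideanSpace ℝ (Fin n) →ₗ[ℝ] EuclideanSpace ℝ (Fin m))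
  (D : EuclideanSpace ℝ (Fin p) →ₗ[ℝ] EuclideanSpace ℝ (Fin n))
  (f : EuclideanSpace ℝ (Fin m) → WithTop ℝ)

/-- The analysis operator `x ↦ (D^* x)_g`. -/
noncomputable def groupAnalysis (g : Fin q) : EuclideanSpace ℝ (Fin n) →ₗ[ℝ] V g :=
  (DirectSum.component ℝ (Fin q) (fun g => V g) g).comp
    ((LinearEquiv.ofBijective (DirectSum.coeLinearMap V) hV).symm.toLinearMap.comp
      (LinearMap.adjoint D))

lemma groupNorm_adjoint (x : EuclideanSpace ℝ (Fin n)) :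
    groupNorm V hV (LinearMap.adjoint D x) = ∑ g, ‖groupAnalysis V hV D g x‖ := rfl

lemma coe_finitePart {F : Type*} {f : F → WithTop ℝ} {z : F} (hz : z ∈ dom f) :
    ((finitePart f z : ℝ) : WithTop ℝ) = f z := by
  obtain ⟨r, hr⟩ := WithTop.ne_top_iff_exists.1 (show f z < ⊤ from hz).ne
  simp [finitePart, ← hr]

lemma regularizedObjective_eq {x : EuclideanSpace ℝ (Fin n)} (hx : Φ x ∈ dom f) (μ : ℝ) :
    regularizedObjective V hV Φ D f μ x =
      ((finitePart f (Φ x) + μ * ∑ g, ‖groupAnalysis V hV D g x‖ : ℝ) : WithTop ℝ) := by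
  rw [WithTop.coe_add, coe_finitePart hx]
  rfl

lemma constrainedObjective_eq {x x₀ : EuclideanSpace ℝ (Fin n)} (hx : Φ x = Φ x₀) :
    constrainedObjective V hV Φ D x₀ x =
      ((∑ g, ‖groupAnalysis V hV D g x‖ : ℝ) : WithTop ℝ) := by
  simp [constrainedObjective, indicator, hx, groupNorm_adjoint]

lemma constrainedObjective_eq_top {x x₀ : EuclideanSpace ℝ (Fin n)} (hx : Φ x ≠ Φ x₀) :
    constrainedObjective V hV Φ D x₀ x = ⊤ := by
  simp [constrainedObjective, indicator, hx]

variable {V hV Φ D f} {μ : ℝ} {xbar : EuclideanSpace ℝ (Fin n)}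

/-- By convexity the objective stays at the optimal value on the segment to a second minimizer,
contradicting growth near `xbar`. -/
lemma IsStrongSolution.isUniqueSolution (hf : IsConvex f) (hμ : 0 < μ)
    (hdom : Φ xbar ∈ dom f) (hsol : IsSolution (regularizedObjective V hV Φ D f μ) xbar)
    (h : IsStrongSolution (regularizedObjective V hV Φ D f μ) xbar) :
    IsUniqueSolution (regularizedObjective V hV Φ D f μ) xbar := by
  refine ⟨hsol, fun y hy => ?_⟩
  obtain ⟨κ, hκ, δ, hδ, hgrow⟩ := h
  have hydom : Φ y ∈ dom f := by
    have h1 := hy xbar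
    rw [regularizedObjective_eq V hV Φ D f hdom] at h1
    by_contra hne
    have : f (Φ y) = ⊤ := not_lt_top_iff.1 hne
    rw [regularizedObjective, this, top_add, top_le_iff] at h1
    exact WithTop.coe_ne_top h1
  have hval := hy xbar
  rw [regularizedObjective_eq V hV Φ D f hdom, regularizedObjective_eq V hV Φ D f hydom,
    WithTop.coe_le_coe] at hval
  by_contra hne
  have hpos : 0 < ‖y - xbar‖ := norm_pos_iff.2 (sub_ne_zero.2 hne)
  -- Keeps the point on the segment and within `δ` of `xbar`.
  set t : ℝ := min 1 (δ / ‖y - xbar‖)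
  have ht0 : 0 < t := lt_min one_pos (div_pos hδ hpos)
  have ht1 : t ≤ 1 := min_le_left _ _
  have htδ : t * ‖y - xbar‖ ≤ δ := (le_div_iff₀ hpos).1 (min_le_right _ _)
  have hg := hgrow ((1 - t) • xbar + t • y) (by
    rw [mem_closedBall_iff_norm]
    have : (1 - t) • xbar + t • y - xbar = t • (y - xbar) := by module
    rwa [this, norm_smul, Real.norm_of_nonneg ht0.le])
  have hconv := hf (x := (Φ xbar, finitePart f (Φ xbar))) (coe_finitePart hdom).ge
    (y := (Φ y, finitePart f (Φ y))) (coe_finitePart hydom).ge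
    (sub_nonneg.2 ht1) ht0.le (sub_add_cancel 1 t)
  simp only [Set.mem_ofPred_eq, Prod.fst_add, Prod.snd_add, Prod.smul_fst, Prod.smul_snd,
    smul_eq_mul, ← map_smul, ← map_add] at hconv
  have hmem : Φ ((1 - t) • xbar + t • y) ∈ dom f := hconv.trans_lt (WithTop.coe_lt_top _)
  rw [← coe_finitePart hmem, WithTop.coe_le_coe] at hconv
  rw [regularizedObjective_eq V hV Φ D f hdom, regularizedObjective_eq V hV Φ D f hmem,
    ← WithTop.coe_add, WithTop.coe_le_coe] at hg
  have hnorm : ∑ g, ‖groupAnalysis V hV D g ((1 - t) • xbar + t • y)‖ ≤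
      (1 - t) * ∑ g, ‖groupAnalysis V hV D g xbar‖ + t * ∑ g, ‖groupAnalysis V hV D g y‖ := by
    rw [Finset.mul_sum, Finset.mul_sum, ← Finset.sum_add_distrib]
    refine Finset.sum_le_sum fun g _ => ?_
    rw [map_add, map_smul, map_smul]
    refine (norm_add_le _ _).trans_eq ?_
    rw [norm_smul, norm_smul, Real.norm_of_nonneg (sub_nonneg.2 ht1), Real.norm_of_nonneg ht0.le]
  have hnorm' := mul_le_mul_of_nonneg_left hnorm hμ.le
  have hval' := mul_le_mul_of_nonneg_left hval ht0.le
  have hsub : (1 - t) • xbar + t • y - xbar = t • (y - xbar) := by module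
  have hquad : 0 < κ / 2 * ‖(1 - t) • xbar + t • y - xbar‖ ^ 2 := by
    rw [hsub, norm_smul, Real.norm_of_nonneg ht0.le]
    positivity
  linarith

/-- On the feasible set `f ∘ Φ` is constant, so the growth belongs to the norm term alone; dividing
by `μ` turns `κ` into `κ / μ`. -/
lemma IsStrongSolution.constrained (hμ : 0 < μ) (hdom : Φ xbar ∈ dom f)
    (h : IsStrongSolution (regularizedObjective V hV Φ D f μ) xbar) :
    IsStrongSolution (constrainedObjective V hV Φ D xbar) xbar := by
  obtain ⟨κ, hκ, δ, hδ, hgrow⟩ := h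
  refine ⟨κ / μ, div_pos hκ hμ, δ, hδ, fun y hy => ?_⟩
  by_cases hΦ : Φ y = Φ xbar
  · have hg := hgrow y hy
    rw [regularizedObjective_eq V hV Φ D f hdom, regularizedObjective_eq V hV Φ D f (hΦ ▸ hdom),
      ← WithTop.coe_add, WithTop.coe_le_coe, hΦ] at hg
    rw [constrainedObjective_eq V hV Φ D hΦ, constrainedObjective_eq V hV Φ D rfl,
      ← WithTop.coe_add, WithTop.coe_le_coe]
    refine le_of_mul_le_mul_left ?_ hμ
    have : μ * (∑ g, ‖groupAnalysis V hV D g xbar‖ + κ / μ / 2 * ‖y - xbar‖ ^ 2)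
        = μ * ∑ g, ‖groupAnalysis V hV D g xbar‖ + κ / 2 * ‖y - xbar‖ ^ 2 := by
      field_simp
    rw [this]
    linarith
  · rw [constrainedObjective_eq_top V hV Φ D hΦ]
    exact le_top

lemma isStrongSolution_of_kernel (hμ : 0 < μ)
    (hsmooth : ContDiffOn ℝ 2 (finitePart f) (interior (dom f)))
    (hess : HessianPosDef f (Φ xbar)) (hint : Φ xbar ∈ interior (dom f))
    (hsol : IsSolution (regularizedObjective V hV Φ D f μ) xbar)
    (hker : ∀ w, Φ w = 0 →
      ∑ g, normCurvature (groupAnalysis V hV D g xbar) (groupAnalysis V hV D g w) = 0 →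
      ∑ g, normSlope (groupAnalysis V hV D g xbar) (groupAnalysis V hV D g w) = 0 → w = 0) :
    IsStrongSolution (regularizedObjective V hV Φ D f μ) xbar := by
  have hdom := interior_subset hint
  -- Since `Φ xbar` is interior to the domain, the objective is finite near `xbar` and the
  -- real-valued theory applies.
  have hmin : IsLocalMin
      (fun y => finitePart f (Φ y) + μ * ∑ g, ‖groupAnalysis V hV D g y‖) xbar := by
    have hev := Φ.continuous_of_finiteDimensional.continuousAt.eventually
      (isOpen_interior.mem_nhds hint)
    filter_upwards [hev] with y hy
    have := hsol y
    rwa [regularizedObjective_eq V hV Φ D f hdom,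
      regularizedObjective_eq V hV Φ D f (interior_subset hy), WithTop.coe_le_coe] at this
  obtain ⟨κ, hκ, hev⟩ := quadratic_growth hμ
    (hsmooth.contDiffAt (isOpen_interior.mem_nhds hint)) hess hmin hker
  obtain ⟨δ, hδ, hball⟩ := Metric.nhds_basis_closedBall.mem_iff.1 hev
  refine ⟨2 * κ, by positivity, δ, hδ, fun y hy => ?_⟩
  by_cases hy' : Φ y ∈ dom f
  · have h1 := hball (show y - xbar ∈ Metric.closedBall 0 δ by
      rw [mem_closedBall_zero_iff]; exact mem_closedBall_iff_norm.1 hy)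
    simp only [Set.mem_ofPred_eq, add_sub_cancel] at h1
    rw [regularizedObjective_eq V hV Φ D f hdom, regularizedObjective_eq V hV Φ D f hy',
      ← WithTop.coe_add, WithTop.coe_le_coe]
    linarith
  · have : f (Φ y) = ⊤ := not_lt_top_iff.1 hy'
    simp [regularizedObjective, this]

/-- Along a critical direction without curvature the constrained objective stays constant. -/
lemma eventually_groupNorm_eq {w : EuclideanSpace ℝ (Fin n)}
    (hQ : ∑ g, normCurvature (groupAnalysis V hV D g xbar) (groupAnalysis V hV D g w) = 0)
    (hS : ∑ g, normSlope (groupAnalysis V hV D g xbar) (groupAnalysis V hV D g w) = 0) :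
    ∀ᶠ t : ℝ in 𝓝[>] 0, ∑ g, ‖groupAnalysis V hV D g (xbar + t • w)‖ =
      ∑ g, ‖groupAnalysis V hV D g xbar‖ := by
  filter_upwards [eventually_sum_norm_add_smul_eq (groupAnalysis V hV D) xbar w hQ] with t ht
  rw [ht, hS, mul_zero, add_zero]

lemma IsUniqueSolution.kernel
    (h : IsUniqueSolution (regularizedObjective V hV Φ D f μ) xbar)
    {w : EuclideanSpace ℝ (Fin n)} (hΦ : Φ w = 0)
    (hQ : ∑ g, normCurvature (groupAnalysis V hV D g xbar) (groupAnalysis V hV D g w) = 0)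
    (hS : ∑ g, normSlope (groupAnalysis V hV D g xbar) (groupAnalysis V hV D g w) = 0) :
    w = 0 := by
  obtain ⟨t, ht, ht0⟩ := ((eventually_groupNorm_eq hQ hS).and self_mem_nhdsWithin).exists
  have ht0 : 0 < t := ht0
  have heq : regularizedObjective V hV Φ D f μ (xbar + t • w)
      = regularizedObjective V hV Φ D f μ xbar := by
    simp only [regularizedObjective, groupNorm_adjoint, ht]
    simp [hΦ]
  have := h.2 (xbar + t • w) fun y => heq ▸ h.1 y
  simpa [ht0.ne'] using this

lemma IsStrongSolution.kernel
    (h : IsStrongSolution (constrainedObjective V hV Φ D xbar) xbar)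
    {w : EuclideanSpace ℝ (Fin n)} (hΦ : Φ w = 0)
    (hQ : ∑ g, normCurvature (groupAnalysis V hV D g xbar) (groupAnalysis V hV D g w) = 0)
    (hS : ∑ g, normSlope (groupAnalysis V hV D g xbar) (groupAnalysis V hV D g w) = 0) :
    w = 0 := by
  obtain ⟨κ, hκ, δ, hδ, hgrow⟩ := h
  have hx : Tendsto (fun t : ℝ => xbar + t • w) (𝓝 0) (𝓝 xbar) := by
    have : Continuous fun t : ℝ => xbar + t • w := by fun_prop
    simpa using this.tendsto 0
  obtain ⟨t, ⟨ht, htδ⟩, ht0⟩ := (((eventually_groupNorm_eq hQ hS).and (nhdsWithin_le_nhds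
    (hx.eventually (Metric.closedBall_mem_nhds xbar hδ)))).and self_mem_nhdsWithin).exists
  have ht0 : 0 < t := ht0
  have hg := hgrow _ htδ
  rw [constrainedObjective_eq V hV Φ D rfl, constrainedObjective_eq V hV Φ D (by simp [hΦ]),
    ← WithTop.coe_add, WithTop.coe_le_coe, ht, add_sub_cancel_left] at hg
  by_contra hne
  have hpos : 0 < ‖t • w‖ := norm_pos_iff.2 (smul_ne_zero ht0.ne' hne)
  have : 0 < κ / 2 * ‖t • w‖ ^ 2 := by positivity
  linarith

end Problem

end GroupSparsity


theorem theorem5p11 {n m p q G : ℕ}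
    (V : Fin q → Submodule ℝ (EuclideanSpace ℝ (Fin p)))
    (hV : DirectSum.IsInternal V)
    (hG : ∀ g, Module.finrank ℝ (V g) = G)
    (Φ : EuclideanSpace ℝ (Fin n) →ₗ[ℝ] EuclideanSpace ℝ (Fin m))
    (D : EuclideanSpace ℝ (Fin p) →ₗ[ℝ] EuclideanSpace ℝ (Fin n))
    (f : EuclideanSpace ℝ (Fin m) → WithTop ℝ)
    (hf_convex : GroupSparsity.IsConvex f)
    (hf_smooth : ContDiffOn ℝ 2 (GroupSparsity.finitePart f)
      (interior (GroupSparsity.dom f)))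
    (hf_hess : ∀ z ∈ interior (GroupSparsity.dom f), GroupSparsity.HessianPosDef f z)
    (μ : ℝ) (hμ : 0 < μ)
    (xbar : EuclideanSpace ℝ (Fin n))
    (hxbar_dom : Φ xbar ∈ interior (GroupSparsity.dom f))
    (hxbar : GroupSparsity.IsSolution
      (GroupSparsity.regularizedObjective V hV Φ D f μ) xbar) :
    List.TFAE
      [GroupSparsity.IsUniqueSolution
        (GroupSparsity.regularizedObjective V hV Φ D f μ) xbar,
       GroupSparsity.IsStrongSolution
        (GroupSparsity.regularizedObjective V hV Φ D f μ) xbar,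
       GroupSparsity.IsStrongSolution
        (GroupSparsity.constrainedObjective V hV Φ D xbar) xbar] := by
  have hdom : Φ xbar ∈ GroupSparsity.dom f := interior_subset hxbar_dom
  have hstrong := GroupSparsity.isStrongSolution_of_kernel hμ hf_smooth
    (hf_hess _ hxbar_dom) hxbar_dom hxbar
  tfae_have 1 → 2 := fun h => hstrong fun w h₁ h₂ h₃ => h.kernel h₁ h₂ h₃
  tfae_have 2 → 1 := fun h => h.isUniqueSolution hf_convex hμ hdom hxbar
  tfae_have 2 → 3 := fun h => h.constrained hμ hdom
  tfae_have 3 → 2 := fun h => hstrong fun w h₁ h₂ h₃ => h.kernel h₁ h₂ h₃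
  tfae_finish
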